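/- Let $\varepsilon>0$, let $\Omega\subset\mathbb{R}^N$ be a bounded, convex domain (in particular open), equipped with the Euclidean distance and the $N$-dimensional Lebesgue measure, let $\mu$ be a probability measure on $\Omega\times\{0,1\}$, and assume that the measures $\varrho_i:=\mu(\,\cdot\times\{i\})$, $i\in\{0,1\}$, are absolutely continuous with respect to the Lebesgue measure; their densities are again denoted by $\varrho_i$. Write $B_\varepsilon(x)=\{y\in\mathbb{R}^N : |x-y|<\varepsilon\}$ and let $$\mathfrak{P}:=\Big\{\Psi\in L^1(\Omega\times\Omega)\ :\ \Psi\ge 0 \text{ a.e. on }\Omega\times\Omega,\quad \int_\Omega\Psi(x,y)\,dy=1 \text{ and } \operatorname{ess\,supp}\Psi(x,\cdot)\subset\overline{B_\varepsilon(x)}\cap\overline{\Omega}\ \text{ for a.e. }x\in\Omega\Big\},$$ where the essential support of a function on $\Omega$ is the complement in $\mathbb{R}^N$ of the largest open set $U$ such that the function vanishes a.e. on $U\cap\Omega$. Then for every $u\in L^\infty(\Omega)$ all integrals below are well defined and finite, $\mathfrak{P}$ is nonempty, and $$\int_\Omega \operatorname*{ess\,sup}_{B_\varepsilon(x)\cap\Omega}u\;\varrho_0(x)\,dx=\sup_{\Psi\in\mathfrak{P}}\int_\Omega\int_\Omega\Psi(x,y)\,\varrho_0(x)\,u(y)\,dy\,dx$$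 and $$\int_\Omega \operatorname*{ess\,inf}_{B_\varepsilon(x)\cap\Omega}u\;\varrho_1(x)\,dx=\inf_{\Psi\in\mathfrak{P}}\int_\Omega\int_\Omega\Psi(x,y)\,\varrho_1(x)\,u(y)\,dy\,dx,$$ where the essential supremum and infimum are taken with respect to the Lebesgue measure. -/

import Mathlib

namespace AdversarialTV

open MeasureTheory

/-- Essential support of `f` with respect to `ν`: the complement of the largest open set on which
`f` vanishes `ν`-almost everywhere. -/
def essSupport {X : Type*} [TopologicalSpace X] [MeasurableSpace X]
    (ν : Measure X) (f : X → ℝ) : Set X :=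
  (⋃₀ {U : Set X | IsOpen U ∧ ∀ᵐ y ∂(ν.restrict U), f y = 0})ᶜ

/-- The (un-normalized) conditional distribution `ϱ_i = μ(· × {i})` of a measure `μ` on
`Ω × {0, 1}`, regarded as a measure on the ambient space `ℝ^N`. -/
noncomputable def condDistr {N : ℕ} {Ω : Set (EuclideanSpace ℝ (Fin N))}
    (μ : Measure (Ω × Fin 2)) (i : Fin 2) : Measure (EuclideanSpace ℝ (Fin N)) :=
  (μ.restrict (Set.univ ×ˢ {i})).map (fun p => (p.1 : EuclideanSpace ℝ (Fin N)))

/-- The real-valued Lebesgue density of `ϱ_i`. -/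
noncomputable def density {N : ℕ} {Ω : Set (EuclideanSpace ℝ (Fin N))}
    (μ : Measure (Ω × Fin 2)) (i : Fin 2) (x : EuclideanSpace ℝ (Fin N)) : ℝ :=
  ((condDistr μ i).rnDeriv volume x).toReal

/-- The set of test functions. Elements of `L¹(Ω × Ω)` are represented by functions, and every
condition is invariant under changing the representative on a null set of `Ω × Ω`; accordingly
the conditions on the sections `Ψ(x, ·)` are imposed for almost every `x ∈ Ω`. -/
def testFunctions {N : ℕ} (Ω : Set (EuclideanSpace ℝ (Fin N))) (ε : ℝ) :
    Set (EuclideanSpace ℝ (Fin N) × EuclideanSpace ℝ (Fin N) → ℝ) :=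
  {Ψ | MemLp Ψ 1 ((volume.restrict Ω).prod (volume.restrict Ω)) ∧
    (∀ᵐ p ∂((volume.restrict Ω).prod (volume.restrict Ω)), 0 ≤ Ψ p) ∧
    (∀ᵐ x ∂(volume.restrict Ω), ∫ y in Ω, Ψ (x, y) = 1) ∧
    (∀ᵐ x ∂(volume.restrict Ω),
      essSupport (volume.restrict Ω) (fun y => Ψ (x, y)) ⊆ Metric.closedBall x ε ∩ closure Ω)}

end AdversarialTV

namespace AdversarialTV

open MeasureTheory Set

section EssSup

variable {X : Type*} [MeasurableSpace X] {κ : Measure X} {v : X → ℝ} {M : ℝ}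

/-! For a.e. `x`, `Ψ (x, ·)` is a probability density carried by the closed `ε`-ball. Spheres are
null, so it averages `u` over the open ball and cannot exceed the essential supremum `S x` there;
integrating against `ρ ≥ 0` gives the upper bound (`integral_testFunction_le`). Conversely, the
uniform density on the points of `ball x ε ∩ Ω` where `u > S x - δ`, a set of positive finite
measure, loses at most `δ * ∫ ρ` (`exists_testFunction_near_essSup`); then `δ → 0`. Measurability of
`S` and of this density rests on `lt_essSup_iff_of_abs_le`, which turns `t < S x` into positivity of
the measure of a section. The infimum formula is the supremum formula for `-u`. -/

theorem ae_le_essSup_of_abs_le (hv : ∀ y, |v y| ≤ M) : ∀ᵐ y ∂κ, v y ≤ essSup v κ :=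
  ae_le_essSup ⟨M, by simpa using Filter.Eventually.of_forall fun y => (abs_le.1 (hv y)).2⟩

/-- For `κ = 0` this can fail: every real is then an essential upper bound, and the real `sInf` of
the whole line takes the default value `0`. -/
theorem lt_essSup_iff_of_abs_le (hκ : κ ≠ 0) (hv : ∀ y, |v y| ≤ M) (t : ℝ) :
    t < essSup v κ ↔ κ {y | t < v y} ≠ 0 := by
  constructor
  · intro h h0
    refine h.not_ge ?_
    rw [essSup_eq_sInf]
    refine csInf_le ⟨-M, fun a ha => ?_⟩ h0
    by_contra! hlt
    have huniv : {x | a < v x} = univ :=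
      eq_univ_of_forall fun y => hlt.trans_le (abs_le.1 (hv y)).1
    rw [mem_ofPred_eq, huniv] at ha
    exact hκ (Measure.measure_univ_eq_zero.1 ha)
  · intro h
    by_contra! hle
    refine h ?_
    have := ae_le_essSup_of_abs_le (κ := κ) hv
    rw [ae_iff] at this
    exact measure_mono_null (fun y (hy : t < v y) => (hle.trans_lt hy).not_ge) this

theorem abs_essSup_le_of_abs_le (hκ : κ ≠ 0) (hv : ∀ y, |v y| ≤ M) : |essSup v κ| ≤ M := by
  rw [abs_le]
  constructor
  · by_contra! h
    obtain ⟨t, h1, h2⟩ := exists_between h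
    refine hκ (Measure.measure_univ_eq_zero.1 ?_)
    have := (lt_essSup_iff_of_abs_le hκ hv t).not.1 h1.not_gt
    rw [not_not] at this
    have huniv : {y | t < v y} = univ :=
      eq_univ_of_forall fun y => h2.trans_le (abs_le.1 (hv y)).1
    rwa [huniv] at this
  · by_contra! h
    refine (lt_essSup_iff_of_abs_le hκ hv M).1 h ?_
    have : {y | M < v y} = ∅ := eq_empty_of_forall_notMem fun y hy =>
      (abs_le.1 (hv y)).2.not_gt hy
    rw [this, measure_empty]

theorem essSup_neg_real (κ : Measure X) (u : X → ℝ) :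
    essSup (fun x => -u x) κ = -essInf u κ := by
  rw [essSup_eq_sInf, essInf_eq_sSup, ← Real.sInf_neg]
  congr 1
  ext a
  simp only [mem_ofPred_eq, mem_neg]
  congr! 4 with x
  exact lt_neg

/-- A function in `L^∞` agrees almost everywhere with a bounded measurable function. -/
theorem exists_measurable_abs_le_ae_eq {u : X → ℝ} (hu : MemLp u ⊤ κ) :
    ∃ (v : X → ℝ) (M : ℝ), Measurable v ∧ (∀ y, |v y| ≤ M) ∧ u =ᵐ[κ] v := by
  obtain ⟨w, hw, huw⟩ := hu.aestronglyMeasurable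
  set M := (eLpNormEssSup u κ).toReal with hM
  have hfin : eLpNormEssSup u κ ≠ ⊤ := by
    have := hu.eLpNorm_ne_top
    rwa [eLpNorm_exponent_top] at this
  refine ⟨fun y => max (-M) (min (w y) M), M,
    measurable_const.max (hw.measurable.min measurable_const), fun y => ?_, ?_⟩
  · have : 0 ≤ M := ENNReal.toReal_nonneg
    exact abs_le.2 ⟨le_max_left _ _, max_le (by linarith) (min_le_right _ _)⟩
  · filter_upwards [huw, ae_le_eLpNormEssSup (f := u) (μ := κ)] with y hy hle
    have h := ENNReal.toReal_mono hfin hle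
    rw [toReal_enorm, Real.norm_eq_abs, ← hM, abs_le] at h
    rw [← hy, min_eq_left h.2, max_eq_right h.1]

end EssSup

/-- A function vanishes almost everywhere off its essential support. -/
theorem ae_eq_zero_of_notMem_essSupport {X : Type*} [TopologicalSpace X]
    [SecondCountableTopology X] [MeasurableSpace X] [OpensMeasurableSpace X]
    -- The union of open null sets may be uncountable; the Lindelöf property reduces it to a
    -- countable one.
    (ν : Measure X) (f : X → ℝ) : ∀ᵐ y ∂ν, y ∉ essSupport ν f → f y = 0 := by
  obtain ⟨T, hTc, hTS, hTU⟩ := TopologicalSpace.isOpen_sUnion_countable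
    {U : Set X | IsOpen U ∧ ∀ᵐ y ∂(ν.restrict U), f y = 0} fun s hs => hs.1
  have h : ∀ᵐ y ∂ν, ∀ U ∈ T, y ∈ U → f y = 0 := by
    rw [ae_ball_iff hTc]
    exact fun U hU => (ae_restrict_iff' (hTS hU).1.measurableSet).1 (hTS hU).2
  filter_upwards [h] with y hy hmem
  rw [essSupport, notMem_compl_iff, ← hTU] at hmem
  obtain ⟨U, hU, hyU⟩ := hmem
  exact hy U hU hyU

section Core

variable {N : ℕ} {Ω : Set (EuclideanSpace ℝ (Fin N))} {ε M : ℝ}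
  {v ρ : EuclideanSpace ℝ (Fin N) → ℝ}
  {Ψ : EuclideanSpace ℝ (Fin N) × EuclideanSpace ℝ (Fin N) → ℝ}

theorem restrict_ball_inter_ne_zero (hΩ : IsOpen Ω) (hε : 0 < ε)
    {x : EuclideanSpace ℝ (Fin N)} (hx : x ∈ Ω) :
    (volume.restrict (Metric.ball x ε ∩ Ω) : Measure (EuclideanSpace ℝ (Fin N))) ≠ 0 := by
  rw [Ne, Measure.restrict_eq_zero]
  exact ((Metric.isOpen_ball.inter hΩ).measure_pos volume
    ⟨x, Metric.mem_ball_self hε, hx⟩).ne'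

theorem measurableSet_dist_lt :
    MeasurableSet {p : EuclideanSpace ℝ (Fin N) × EuclideanSpace ℝ (Fin N) |
      dist p.2 p.1 < ε} :=
  measurableSet_lt (measurable_snd.dist measurable_fst) measurable_const

/-- Superlevel sets are described by the measure of sections of a measurable subset of the product.
The indicator is there because off `Ω` the set `ball x ε ∩ Ω` may be null. -/
theorem measurable_indicator_essSup_ball (hΩ : IsOpen Ω) (hε : 0 < ε) (hv : Measurable v)
    (hM : ∀ y, |v y| ≤ M) :
    Measurable (Ω.indicator fun x => essSup v (volume.restrict (Metric.ball x ε ∩ Ω))) := by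
  refine measurable_of_Ioi fun t => ?_
  have hS : MeasurableSet {p : EuclideanSpace ℝ (Fin N) × EuclideanSpace ℝ (Fin N) |
      t < v p.2 ∧ dist p.2 p.1 < ε ∧ p.2 ∈ Ω} :=
    (measurableSet_lt measurable_const (hv.comp measurable_snd)).inter
      (measurableSet_dist_lt.inter (measurable_snd hΩ.measurableSet))
  have hm := measurable_measure_prodMk_left
    (ν := (volume : Measure (EuclideanSpace ℝ (Fin N)))) hS
  have heq : (Ω.indicator fun x => essSup v (volume.restrict (Metric.ball x ε ∩ Ω))) ⁻¹' Ioi t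
      = (Ω ∩ (fun x => volume (Prod.mk x ⁻¹' {p : EuclideanSpace ℝ (Fin N) ×
        EuclideanSpace ℝ (Fin N) | t < v p.2 ∧ dist p.2 p.1 < ε ∧ p.2 ∈ Ω})) ⁻¹' {0}ᶜ)
        ∪ (Ωᶜ ∩ {_x | t < 0}) := by
    ext x
    by_cases hx : x ∈ Ω
    · simp only [mem_preimage, indicator_of_mem hx, mem_Ioi,
        lt_essSup_iff_of_abs_le (restrict_ball_inter_ne_zero hΩ hε hx) hM,
        Measure.restrict_apply (measurableSet_lt measurable_const hv)]
      simp only [mem_union, mem_inter_iff, hx, true_and, mem_compl_iff, not_true_eq_false,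
        false_and, or_false, mem_preimage, mem_singleton_iff]
      rfl
    · simp [hx]
  rw [heq]
  exact (hΩ.measurableSet.inter (hm (measurableSet_singleton 0).compl)).union
    (hΩ.measurableSet.compl.inter (MeasurableSet.const _))

theorem integrableOn_essSup_ball_mul (hΩ : IsOpen Ω) (hε : 0 < ε) (hv : Measurable v)
    (hM : ∀ y, |v y| ≤ M) (hρ : IntegrableOn ρ Ω) :
    IntegrableOn (fun x => essSup v (volume.restrict (Metric.ball x ε ∩ Ω)) * ρ x) Ω := by
  have h : IntegrableOn (fun x =>
      (Ω.indicator fun x => essSup v (volume.restrict (Metric.ball x ε ∩ Ω))) x * ρ x) Ω := by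
    refine Integrable.bdd_mul (c := M) hρ
      (measurable_indicator_essSup_ball hΩ hε hv hM).aestronglyMeasurable ?_
    filter_upwards [ae_restrict_mem hΩ.measurableSet] with x hx
    rw [indicator_of_mem hx, Real.norm_eq_abs]
    exact abs_essSup_le_of_abs_le (restrict_ball_inter_ne_zero hΩ hε hx) hM
  refine h.congr_fun (fun x hx => ?_) hΩ.measurableSet
  simp only [indicator_of_mem hx]

/-- `ρ` may be unbounded, so integrability of `Ψ` alone is not enough: the normalization of the
sections makes the inner integral of the norm equal to `|ρ x|`. -/
theorem integrable_testFunction_mul (hΨ : Ψ ∈ testFunctions Ω ε)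
    (hρ : IntegrableOn ρ Ω) :
    Integrable (fun p => Ψ p * ρ p.1) ((volume.restrict Ω).prod (volume.restrict Ω)) := by
  obtain ⟨h1, h2, h3, -⟩ := hΨ
  rw [memLp_one_iff_integrable] at h1
  have hmeas : AEStronglyMeasurable (fun p => Ψ p * ρ p.1)
      ((volume.restrict Ω).prod (volume.restrict Ω)) :=
    h1.aestronglyMeasurable.mul hρ.aestronglyMeasurable.comp_fst
  rw [integrable_prod_iff hmeas]
  constructor
  · filter_upwards [h1.prod_right_ae] with x hx
    exact hx.mul_const _
  · refine hρ.norm.congr ?_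
    filter_upwards [h3, Measure.ae_ae_of_ae_prod h2] with x hx hpos
    have : ∫ y in Ω, ‖Ψ (x, y)‖ = 1 := by
      rw [← hx]
      refine integral_congr_ae ?_
      filter_upwards [hpos] with y hy
      exact Real.norm_of_nonneg hy
    simp only [norm_mul]
    rw [integral_mul_const, this, one_mul]

theorem integrable_testFunction_mul_mul (hΨ : Ψ ∈ testFunctions Ω ε)
    (hρ : IntegrableOn ρ Ω) (hv : Measurable v) (hM : ∀ y, |v y| ≤ M) :
    Integrable (fun p => Ψ p * ρ p.1 * v p.2)
      ((volume.restrict Ω).prod (volume.restrict Ω)) :=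
  (integrable_testFunction_mul hΨ hρ).mul_bdd (c := M)
    (hv.comp measurable_snd).aestronglyMeasurable (Filter.Eventually.of_forall fun p => hM p.2)

theorem ae_notMem_closedBall_diff_ball (hε : 0 < ε) (x : EuclideanSpace ℝ (Fin N)) :
    ∀ᵐ y ∂(volume.restrict Ω), y ∈ Metric.closedBall x ε → y ∈ Metric.ball x ε := by
  have h : ∀ᵐ y ∂(volume : Measure (EuclideanSpace ℝ (Fin N))), y ∉ Metric.sphere x ε :=
    measure_eq_zero_iff_ae_notMem.1 (Measure.addHaar_sphere_of_ne_zero volume x hε.ne')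
  filter_upwards [ae_restrict_of_ae h] with y hy hc
  exact lt_of_le_of_ne hc hy

theorem integral_testFunction_le (hΩ : IsOpen Ω) (hε : 0 < ε) (hΨ : Ψ ∈ testFunctions Ω ε)
    (hρ : IntegrableOn ρ Ω) (hρ0 : ∀ x, 0 ≤ ρ x) (hv : Measurable v) (hM : ∀ y, |v y| ≤ M) :
    ∫ x in Ω, ∫ y in Ω, Ψ (x, y) * ρ x * v y ≤
      ∫ x in Ω, essSup v (volume.restrict (Metric.ball x ε ∩ Ω)) * ρ x := by
  have hint := integrable_testFunction_mul_mul hΨ hρ hv hM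
  refine integral_mono_ae hint.integral_prod_left
    (integrableOn_essSup_ball_mul hΩ hε hv hM hρ) ?_
  obtain ⟨h1, h2, h3, h4⟩ := hΨ
  rw [memLp_one_iff_integrable] at h1
  filter_upwards [hint.prod_right_ae, h1.prod_right_ae, Measure.ae_ae_of_ae_prod h2, h3, h4]
    with x hix hΨx hpos hone hsupp
  set S := essSup v (volume.restrict (Metric.ball x ε ∩ Ω)) with hS
  have hle : ∀ᵐ y ∂(volume.restrict Ω), y ∈ Metric.ball x ε → v y ≤ S := by
    have := ae_le_essSup_of_abs_le (κ := volume.restrict (Metric.ball x ε ∩ Ω)) hM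
    rw [← hS, ← Measure.restrict_restrict Metric.isOpen_ball.measurableSet] at this
    exact (ae_restrict_iff' Metric.isOpen_ball.measurableSet).1 this
  calc ∫ y in Ω, Ψ (x, y) * ρ x * v y ≤ ∫ y in Ω, Ψ (x, y) * (S * ρ x) := by
        refine integral_mono_ae hix (hΨx.mul_const _) ?_
        filter_upwards [hpos, hle, ae_notMem_closedBall_diff_ball (Ω := Ω) hε x,
          ae_eq_zero_of_notMem_essSupport (volume.restrict Ω) fun y => Ψ (x, y)]
          with y hy hvy hball hzero
        by_cases hc : y ∈ Metric.closedBall x ε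
        · have := mul_le_mul_of_nonneg_left (hvy (hball hc)) (mul_nonneg hy (hρ0 x))
          linarith
        · have : Ψ (x, y) = 0 := hzero fun h => hc (hsupp h).1
          simp [this]
    _ = S * ρ x := by rw [integral_mul_const, hone, one_mul]

/-- For every `δ > 0`, a test function concentrated where `v` is within `δ` of its essential
supremum over the ball. -/
theorem exists_testFunction_near_essSup (hΩ : IsOpen Ω) (hfin : volume Ω ≠ ⊤) (hε : 0 < ε)
    (hv : Measurable v) (hM : ∀ y, |v y| ≤ M) {δ : ℝ} (hδ : 0 < δ) :
    ∃ Ψ ∈ testFunctions Ω ε, (∀ p, 0 ≤ Ψ p) ∧ ∀ x ∈ Ω, ∀ y, Ψ (x, y) ≠ 0 →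
      essSup v (volume.restrict (Metric.ball x ε ∩ Ω)) - δ < v y := by
  have : IsFiniteMeasure (volume.restrict Ω) := ⟨by simpa using hfin.lt_top⟩
  set S := Ω.indicator fun x => essSup v (volume.restrict (Metric.ball x ε ∩ Ω)) with hS
  have hSm : Measurable S := measurable_indicator_essSup_ball hΩ hε hv hM
  set A : Set (EuclideanSpace ℝ (Fin N) × EuclideanSpace ℝ (Fin N)) :=
    {p | S p.1 - δ < v p.2} ∩ {p | dist p.2 p.1 < ε} with hA
  have hAm : MeasurableSet A :=
    (measurableSet_lt ((hSm.comp measurable_fst).sub measurable_const)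
      (hv.comp measurable_snd)).inter measurableSet_dist_lt
  set m : EuclideanSpace ℝ (Fin N) → ℝ := fun x => (volume.restrict Ω).real (Prod.mk x ⁻¹' A)
    with hm
  have hmm : Measurable m := (measurable_measure_prodMk_left hAm).ennreal_toReal
  have hmpos : ∀ x ∈ Ω, 0 < m x := by
    intro x hx
    refine ENNReal.toReal_pos ?_ (measure_ne_top _ _)
    have hlt : S x - δ < essSup v (volume.restrict (Metric.ball x ε ∩ Ω)) := by
      rw [hS, indicator_of_mem hx]
      linarith
    have h := (lt_essSup_iff_of_abs_le (restrict_ball_inter_ne_zero hΩ hε hx) hM _).1 hlt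
    rwa [← Measure.restrict_restrict Metric.isOpen_ball.measurableSet,
      Measure.restrict_apply (measurableSet_lt measurable_const hv)] at h
  -- The section at `x ∈ Ω` is the uniform probability density on the section of `A`.
  set Ψ : EuclideanSpace ℝ (Fin N) × EuclideanSpace ℝ (Fin N) → ℝ :=
    A.indicator fun p => (m p.1)⁻¹ with hΨ
  have hΨm : Measurable Ψ := (hmm.comp measurable_fst).inv.indicator hAm
  have hΨ0 : ∀ p, 0 ≤ Ψ p := fun p =>
    indicator_nonneg (fun p _ => inv_nonneg.2 ENNReal.toReal_nonneg) p
  have hsec : ∀ x, (fun y => Ψ (x, y)) = (Prod.mk x ⁻¹' A).indicator fun _ => (m x)⁻¹ :=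
    fun x => rfl
  have hAx : ∀ x, MeasurableSet (Prod.mk x ⁻¹' A) := fun x => measurable_prodMk_left hAm
  have hone : ∀ x ∈ Ω, ∫ y in Ω, Ψ (x, y) = 1 := by
    intro x hx
    rw [hsec, integral_indicator_const _ (hAx x), smul_eq_mul]
    exact mul_inv_cancel₀ (hmpos x hx).ne'
  refine ⟨Ψ, ⟨?_, Filter.Eventually.of_forall hΨ0, ?_, ?_⟩, hΨ0, ?_⟩
  · rw [memLp_one_iff_integrable, integrable_prod_iff hΨm.aestronglyMeasurable]
    constructor
    · refine Filter.Eventually.of_forall fun x => ?_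
      rw [hsec]
      exact (integrable_const _).indicator (hAx x)
    · refine (integrable_const (1 : ℝ)).congr ?_
      filter_upwards [ae_restrict_mem hΩ.measurableSet] with x hx
      simp only [Real.norm_of_nonneg (hΨ0 _)]
      exact (hone x hx).symm
  · filter_upwards [ae_restrict_mem hΩ.measurableSet] with x hx using hone x hx
  -- The complement of the closed target set is itself an open set on which `Ψ (x, ·)` vanishes a.e.
  · refine Filter.Eventually.of_forall fun x => compl_subset_comm.1 fun y hy => ?_
    refine mem_sUnion.2 ⟨_, ⟨(Metric.isClosed_closedBall.inter isClosed_closure).isOpen_compl,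
      ?_⟩, hy⟩
    rw [ae_restrict_iff' (Metric.isClosed_closedBall.inter
      isClosed_closure).isOpen_compl.measurableSet]
    filter_upwards [ae_restrict_mem hΩ.measurableSet] with z hz hzc
    refine indicator_of_notMem (fun hzA => hzc ⟨?_, subset_closure hz⟩) _
    exact (show dist z x < ε from hzA.2).le
  · intro x hx y hy
    have hmem : (x, y) ∈ A := by
      by_contra h
      exact hy (indicator_of_notMem h _)
    have := hmem.1
    simp only [mem_ofPred_eq, hS, indicator_of_mem hx] at this
    exact this

theorem isLUB_integral_testFunction_of_measurable (hΩ : IsOpen Ω) (hfin : volume Ω ≠ ⊤)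
    (hε : 0 < ε) (hρ : IntegrableOn ρ Ω) (hρ0 : ∀ x, 0 ≤ ρ x) (hv : Measurable v)
    (hM : ∀ y, |v y| ≤ M) :
    IsLUB ((fun Ψ => ∫ x in Ω, ∫ y in Ω, Ψ (x, y) * ρ x * v y) '' testFunctions Ω ε)
      (∫ x in Ω, essSup v (volume.restrict (Metric.ball x ε ∩ Ω)) * ρ x) := by
  constructor
  · rintro _ ⟨Ψ, hΨ, rfl⟩
    exact integral_testFunction_le hΩ hε hΨ hρ hρ0 hv hM
  · intro b hb
    have key : ∀ δ : ℝ, 0 < δ →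
        ∫ x in Ω, essSup v (volume.restrict (Metric.ball x ε ∩ Ω)) * ρ x
          ≤ b + δ * ∫ x in Ω, ρ x := by
      intro δ hδ
      obtain ⟨Ψ, hΨ, hΨ0, hΨv⟩ :=
        exists_testFunction_near_essSup (M := M) hΩ hfin hε hv hM hδ
      have hint := integrable_testFunction_mul_mul hΨ hρ hv hM
      have hbΨ := hb (mem_image_of_mem _ hΨ)
      have hSint := integrableOn_essSup_ball_mul hΩ hε hv hM hρ
      have h : ∫ x in Ω, (essSup v (volume.restrict (Metric.ball x ε ∩ Ω)) * ρ x - δ * ρ x) ≤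
          ∫ x in Ω, ∫ y in Ω, Ψ (x, y) * ρ x * v y := by
        refine integral_mono_ae (hSint.sub (hρ.const_mul δ)) hint.integral_prod_left ?_
        obtain ⟨h1, -, h3, -⟩ := hΨ
        rw [memLp_one_iff_integrable] at h1
        filter_upwards [hint.prod_right_ae, h1.prod_right_ae, h3,
          ae_restrict_mem hΩ.measurableSet] with x hix hΨx hone hx
        set s := essSup v (volume.restrict (Metric.ball x ε ∩ Ω)) with hs
        calc s * ρ x - δ * ρ x = ∫ y in Ω, Ψ (x, y) * ((s - δ) * ρ x) := by
              rw [integral_mul_const, hone]; ring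
          _ ≤ ∫ y in Ω, Ψ (x, y) * ρ x * v y := by
              refine integral_mono (hΨx.mul_const _) hix fun y => ?_
              by_cases h0 : Ψ (x, y) = 0
              · simp [h0]
              · have := mul_le_mul_of_nonneg_left (hΨv x hx y h0).le
                  (mul_nonneg (hΨ0 (x, y)) (hρ0 x))
                simp only
                linarith
      rw [integral_sub hSint (hρ.const_mul δ), integral_const_mul] at h
      linarith
    refine le_of_forall_pos_le_add fun η hη => ?_
    have hI : 0 ≤ ∫ x in Ω, ρ x := integral_nonneg hρ0
    -- The `+ 1` keeps the denominator positive when `∫ ρ = 0`.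
    refine (key (η / ((∫ x in Ω, ρ x) + 1)) (by positivity)).trans ?_
    gcongr
    rw [div_mul_eq_mul_div, div_le_iff₀ (by positivity)]
    nlinarith

/-- The integral of the essential suprema over balls is the supremum over test functions,
together with the well-definedness of all integrals involved. -/
theorem isLUB_integral_testFunction (hΩ : IsOpen Ω) (hfin : volume Ω ≠ ⊤)
    (hε : 0 < ε) (hρ : IntegrableOn ρ Ω) (hρ0 : ∀ x, 0 ≤ ρ x)
    {u : EuclideanSpace ℝ (Fin N) → ℝ} (hu : MemLp u ⊤ (volume.restrict Ω)) :
    IntegrableOn (fun x => essSup u (volume.restrict (Metric.ball x ε ∩ Ω)) * ρ x) Ω ∧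
    (∀ Ψ ∈ testFunctions Ω ε, Integrable (fun p => Ψ p * ρ p.1 * u p.2)
      ((volume.restrict Ω).prod (volume.restrict Ω))) ∧
    IsLUB ((fun Ψ => ∫ x in Ω, ∫ y in Ω, Ψ (x, y) * ρ x * u y) '' testFunctions Ω ε)
      (∫ x in Ω, essSup u (volume.restrict (Metric.ball x ε ∩ Ω)) * ρ x) := by
  -- All the integrals depend only on the a.e. class of `u` on `Ω`, so a bounded measurable
  -- representative suffices.
  obtain ⟨v, M, hv, hM, huv⟩ := exists_measurable_abs_le_ae_eq hu
  have hess : ∀ x, essSup u (volume.restrict (Metric.ball x ε ∩ Ω)) =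
      essSup v (volume.restrict (Metric.ball x ε ∩ Ω)) := fun x =>
    essSup_congr_ae (ae_restrict_of_ae_restrict_of_subset inter_subset_right huv)
  have hinner : ∀ (Ψ : EuclideanSpace ℝ (Fin N) × EuclideanSpace ℝ (Fin N) → ℝ) x,
      ∫ y in Ω, Ψ (x, y) * ρ x * u y = ∫ y in Ω, Ψ (x, y) * ρ x * v y := by
    refine fun Ψ x => integral_congr_ae ?_
    filter_upwards [huv] with y hy
    rw [hy]
  simp only [hess, hinner]
  refine ⟨integrableOn_essSup_ball_mul hΩ hε hv hM hρ, fun Ψ hΨ => ?_,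
    isLUB_integral_testFunction_of_measurable hΩ hfin hε hρ hρ0 hv hM⟩
  refine (integrable_testFunction_mul_mul hΨ hρ hv hM).congr ?_
  have := Measure.quasiMeasurePreserving_snd (μ := volume.restrict Ω)
    (ν := volume.restrict Ω) |>.ae_eq_comp huv
  filter_upwards [this] with p hp
  simp only [Function.comp_apply] at hp
  rw [hp]

theorem integrableOn_density (μ : Measure (Ω × Fin 2)) [IsFiniteMeasure μ] (i : Fin 2) :
    IntegrableOn (density μ i) Ω := by
  have : IsFiniteMeasure (condDistr μ i) := by unfold condDistr; infer_instance
  exact (Measure.integrable_toReal_rnDeriv (μ := condDistr μ i) (ν := volume)).integrableOn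

theorem density_nonneg (μ : Measure (Ω × Fin 2)) (i : Fin 2) (x : EuclideanSpace ℝ (Fin N)) :
    0 ≤ density μ i x := ENNReal.toReal_nonneg

end Core

end AdversarialTV

-- Nonemptiness of the class of test functions is contained in `IsLUB`: in `ℝ` the empty set has no
-- least upper bound.
open MeasureTheory AdversarialTV in
theorem mainTheorem5 {N : ℕ} (Ω : Set (EuclideanSpace ℝ (Fin N)))
    (hΩ_open : IsOpen Ω) (hΩ_bdd : Bornology.IsBounded Ω) (hΩ_conv : Convex ℝ Ω)
    (ε : ℝ) (hε : 0 < ε)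
    (μ : Measure (Ω × Fin 2)) [IsProbabilityMeasure μ]
    (hμ : ∀ i : Fin 2, condDistr μ i ≪ volume)
    (u : EuclideanSpace ℝ (Fin N) → ℝ) (hu : MemLp u ⊤ (volume.restrict Ω)) :
    -- all integrals below are well defined
    (IntegrableOn
        (fun x => essSup u (volume.restrict (Metric.ball x ε ∩ Ω)) * density μ 0 x) Ω ∧
      IntegrableOn
        (fun x => essInf u (volume.restrict (Metric.ball x ε ∩ Ω)) * density μ 1 x) Ω ∧
      ∀ Ψ ∈ testFunctions Ω ε, ∀ i : Fin 2,
        Integrable (fun p => Ψ p * density μ i p.1 * u p.2)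
          ((volume.restrict Ω).prod (volume.restrict Ω))) ∧
    -- the supremum formula
    IsLUB
      ((fun Ψ => ∫ x in Ω, ∫ y in Ω, Ψ (x, y) * density μ 0 x * u y) '' testFunctions Ω ε)
      (∫ x in Ω, essSup u (volume.restrict (Metric.ball x ε ∩ Ω)) * density μ 0 x) ∧
    -- the infimum formula
    IsGLB
      ((fun Ψ => ∫ x in Ω, ∫ y in Ω, Ψ (x, y) * density μ 1 x * u y) '' testFunctions Ω ε)
      (∫ x in Ω, essInf u (volume.restrict (Metric.ball x ε ∩ Ω)) * density μ 1 x) := by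
  have hfin : volume Ω ≠ ⊤ := hΩ_bdd.measure_lt_top.ne
  have hsup := fun i => isLUB_integral_testFunction hΩ_open hfin hε (integrableOn_density μ i)
    (density_nonneg μ i) hu
  obtain ⟨hint, -, hlub⟩ := isLUB_integral_testFunction hΩ_open hfin hε
    (integrableOn_density μ 1) (density_nonneg μ 1) (u := fun x => -u x) hu.neg
  simp only [essSup_neg_real, neg_mul, mul_neg, integral_neg] at hint hlub
  refine ⟨⟨(hsup 0).1, ?_, fun Ψ hΨ i => (hsup i).2.1 Ψ hΨ⟩, (hsup 0).2.2, ?_⟩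
  · simpa using hint.neg
  · rw [← isGLB_neg, ← Set.image_neg_eq_neg, Set.image_image] at hlub
    simpa only [neg_neg] using hlub
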